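/- Let $d_x,d_y,k\ge 1$ be fixed integers and $\delta>0$. Let $(X_1,Y_1),(X_2,Y_2),\dots$ be i.i.d. random vectors in $\mathbb R^{d_x}\times\mathbb R^{d_y}$ with joint probability density $f$ (with respect to Lebesgue measure), marginal densities $f_X(x)=\int f(x,y)\,dy$, $f_Y(y)=\int f(x,y)\,dx$, and conditional densities $f_{Y|X}=f/f_X$, $f_{X|Y}=f/f_Y$. For a sample of size $N>k$ and $p\in\{2,\infty\}$ let $\rho_{k,i,p}$ be the $\ell_p$ distance in $\mathbb R^{d_x+d_y}$ from $(X_i,Y_i)$ to its $k$-th nearest neighbour among the other $N-1$ sample points, and let $$n_{x,i,p}=\#\{j\ne i:\|X_j-X_i\|_p\le\rho_{k,i,p}\},\qquad n_{y,i,p}=\#\{j\ne i:\|Y_j-Y_i\|_p\le\rho_{k,i,p}\}.$$ Let $a_N=\big((\log N)^{1+\delta}/N\big)^{1/(d_x+d_y)}$, let $\psi=\Gamma'/\Gamma$ be the digamma function, and let $c_{d,2}=\pi^{d/2}/\Gamma(\tfrac d2+1)$. Put $$\iota_{k,i,\infty}=\psi(k)+\log N-\psi(n_{x,i,\infty}+1)-\psi(n_{y,i,\infty}+1)\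 \text{ if }\rho_{k,i,\infty}\le a_N,\qquad \iota_{k,i,\infty}=0\text{ otherwise},$$ $$\iota_{k,i,2}=\psi(k)+\log N+\log\frac{c_{d_x,2}\,c_{d_y,2}}{c_{d_x+d_y,2}}-\log n_{x,i,2}-\log n_{y,i,2}\ \text{ if }\rho_{k,i,2}\le a_N,\qquad \iota_{k,i,2}=0\text{ otherwise}.$$ The truncated KSG and the truncated BI-KSG estimators are $\widehat I_{\rm tKSG}=\frac1N\sum_{i=1}^N\iota_{k,i,\infty}$ and $\widehat I_{\rm tBI\text{-}KSG}=\frac1N\sum_{i=1}^N\iota_{k,i,2}$. Assume that there are finite constants $C_a,C_b,C_c,C_d,C_e,C_f,C_g,C_h,C_0$ and $\gamma>0$ such that, with $H_g$ the Hessian of $g$ and $\|\cdot\|$ the spectral norm: (a) $f\le C_a$ almost everywhere; (b) $\int f\,|\log f|^{1+\gamma}\,dx\,dy\le C_b$ (in particular the integral is finite); (c) $\int f\,e^{-bf}\,dx\,dy\le C_c e^{-C_0b}$ for all $b>1$; (d) at almost every point $f$ is twice continuously differentiable (in a neighbourhood of the point) with $\|H_f\|<C_d$; (e) $f_{Y|X}<C_e$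 and $f_{X|Y}<C_e$ almost everywhere; (f) $f_X<C_f$ and $f_Y<C_f$ almost everywhere; (g) the set of points at which (d) is violated, that is, at which $f$ is not twice continuously differentiable or $\|H_f\|\ge C_d$, has $(d_x+d_y-1)$-dimensional Hausdorff measure at most $C_g$; (h) the set of $x$ at which $f_X$ is not twice continuously differentiable or $\|H_{f_X}(x)\|\ge C_d$ has $(d_x-1)$-dimensional Hausdorff measure at most $C_h$, and the set of $y$ at which $f_Y$ is not twice continuously differentiable or $\|H_{f_Y}(y)\|\ge C_d$ has $(d_y-1)$-dimensional Hausdorff measure at most $C_h$. Then both estimators are square integrable for every $N>k$, and, as $N\to\infty$, $$\mathrm{Var}\big[\widehat I_{\rm tKSG}\big]=O\!\left(\frac{(\log\log N)^2(\log N)^{(2k+2)(1+\delta)}}{N}\right),\qquad \mathrm{Var}\big[\widehat I_{\rm tBI\text{-}KSG}\big]=O\!\left(\frac{(\log\log N)^2(\log N)^{(2k+2)(1+\delta)}}{N}\right).$$ -/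

import Mathlib

open MeasureTheory ProbabilityTheory Filter Asymptotics
open scoped ENNReal

noncomputable section

namespace KSG

/-! ### The estimators -/

/-- The `ℓ_p` distance on `ℝ^ι` (used below for `p = 2` and `p = ∞`). -/
def lpDist {ι : Type*} [Fintype ι] (p : ℝ≥0∞) (u v : ι → ℝ) : ℝ :=
  ‖(WithLp.toLp p (u - v) : PiLp p (fun _ : ι => ℝ))‖

/-- The concatenation `(x, y)` as a vector of `ℝ^{d_x + d_y}`. -/
def joint {dx dy : ℕ} (x : Fin dx → ℝ) (y : Fin dy → ℝ) : Fin dx ⊕ Fin dy → ℝ :=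
  Sum.elim x y

/-- `ρ_{k,i,p}`: the `ℓ_p` distance from the sample point `(x_i, y_i)` to its `k`-th nearest
neighbour among the other sample points, that is, the smallest `r` such that at least `k` indices
`j ≠ i` satisfy `‖(x_j, y_j) - (x_i, y_i)‖_p ≤ r`. It is meaningful for `1 ≤ k < N`. -/
def knnDist {dx dy N : ℕ} (p : ℝ≥0∞) (k : ℕ)
    (x : Fin N → Fin dx → ℝ) (y : Fin N → Fin dy → ℝ) (i : Fin N) : ℝ :=
  sInf {r : ℝ | k ≤
    Set.ncard {j : Fin N | j ≠ i ∧ lpDist p (joint (x j) (y j)) (joint (x i) (y i)) ≤ r}}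

/-- The number of `j ≠ i` with `‖x_j - x_i‖_p ≤ r`. -/
def countWithin {d N : ℕ} (p : ℝ≥0∞) (x : Fin N → Fin d → ℝ) (i : Fin N) (r : ℝ) : ℕ :=
  Set.ncard {j : Fin N | j ≠ i ∧ lpDist p (x j) (x i) ≤ r}

/-- The digamma function `ψ = Γ' / Γ` on the real line. -/
def psi (t : ℝ) : ℝ := logDeriv Real.Gamma t

/-- The volume `c_{d,2}` of the Euclidean unit ball of `ℝ^d`. -/
def ballVol (d : ℕ) : ℝ := Real.pi ^ ((d : ℝ) / 2) / Real.Gamma ((d : ℝ) / 2 + 1)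

/-- The truncation threshold `a_N = ((log N)^{1+δ} / N)^{1/(d_x+d_y)}`. -/
def threshold (dx dy : ℕ) (δ : ℝ) (N : ℕ) : ℝ :=
  (Real.log N ^ (1 + δ) / N) ^ (1 / ((dx : ℝ) + dy))

open Classical in
/-- The local information estimate `ι_{k,i,∞}`. -/
def iotaInf {dx dy N : ℕ} (k : ℕ) (δ : ℝ)
    (x : Fin N → Fin dx → ℝ) (y : Fin N → Fin dy → ℝ) (i : Fin N) : ℝ :=
  if knnDist ∞ k x y i ≤ threshold dx dy δ N then
    psi k + Real.log N
      - psi ((countWithin ∞ x i (knnDist ∞ k x y i) : ℝ) + 1)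
      - psi ((countWithin ∞ y i (knnDist ∞ k x y i) : ℝ) + 1)
  else 0

open Classical in
/-- The local information estimate `ι_{k,i,2}`. -/
def iotaTwo {dx dy N : ℕ} (k : ℕ) (δ : ℝ)
    (x : Fin N → Fin dx → ℝ) (y : Fin N → Fin dy → ℝ) (i : Fin N) : ℝ :=
  if knnDist 2 k x y i ≤ threshold dx dy δ N then
    psi k + Real.log N + Real.log (ballVol dx * ballVol dy / ballVol (dx + dy))
      - Real.log (countWithin 2 x i (knnDist 2 k x y i))
      - Real.log (countWithin 2 y i (knnDist 2 k x y i))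
  else 0

/-- The truncated KSG estimator of the mutual information from `N` samples. -/
def tKSG {dx dy N : ℕ} (k : ℕ) (δ : ℝ)
    (x : Fin N → Fin dx → ℝ) (y : Fin N → Fin dy → ℝ) : ℝ :=
  (1 / (N : ℝ)) * ∑ i, iotaInf k δ x y i

/-- The truncated bias-improved KSG estimator of the mutual information from `N` samples. -/
def tBIKSG {dx dy N : ℕ} (k : ℕ) (δ : ℝ)
    (x : Fin N → Fin dx → ℝ) (y : Fin N → Fin dy → ℝ) : ℝ :=
  (1 / (N : ℝ)) * ∑ i, iotaTwo k δ x y i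

/-! ### The assumptions on the joint density -/

/-- The marginal density `f_X`. -/
def marginalX {dx dy : ℕ} (f : (Fin dx → ℝ) × (Fin dy → ℝ) → ℝ) (x : Fin dx → ℝ) : ℝ :=
  ∫ y, f (x, y)

/-- The marginal density `f_Y`. -/
def marginalY {dx dy : ℕ} (f : (Fin dx → ℝ) × (Fin dy → ℝ) → ℝ) (y : Fin dy → ℝ) : ℝ :=
  ∫ x, f (x, y)

/-- `f` as a function on the Euclidean space `ℝ^{d_x + d_y}`. -/
def onJointSpace {dx dy : ℕ} (f : (Fin dx → ℝ) × (Fin dy → ℝ) → ℝ)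
    (v : EuclideanSpace ℝ (Fin dx ⊕ Fin dy)) : ℝ :=
  f (fun a => v (Sum.inl a), fun b => v (Sum.inr b))

/-- `g` is twice continuously differentiable at `v` (that is, in a neighbourhood of `v`), and its
Hessian at `v` has spectral norm `< C`. The second derivative is a bilinear form on a Euclidean
space, so that its operator norm is the spectral norm of the Hessian matrix. -/
def SmoothAt {ι : Type*} [Fintype ι] (g : EuclideanSpace ℝ ι → ℝ) (C : ℝ)
    (v : EuclideanSpace ℝ ι) : Prop :=
  ContDiffAt ℝ 2 g v ∧ ‖fderiv ℝ (fderiv ℝ g) v‖ < C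

/-- Conditions (a)-(h) on a joint density `f`, with the constants made explicit. The measure
`μH[s]` is the `s`-dimensional Hausdorff measure for the Euclidean distance, built from the sums
`∑ (diam U_i)^s`. -/
structure RateConditions {dx dy : ℕ} (f : (Fin dx → ℝ) × (Fin dy → ℝ) → ℝ)
    (γ Ca Cb Cc Cd Ce Cf Cg Ch C0 : ℝ) : Prop where
  bounded : ∀ᵐ z, f z ≤ Ca
  gamma_pos : 0 < γ
  integrable_log : Integrable (fun z => f z * |Real.log (f z)| ^ (1 + γ))
  integral_log : ∫ z, f z * |Real.log (f z)| ^ (1 + γ) ≤ Cb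
  tail : ∀ b : ℝ, 1 < b → ∫ z, f z * Real.exp (-b * f z) ≤ Cc * Real.exp (-C0 * b)
  smooth : ∀ᵐ v, SmoothAt (onJointSpace f) Cd v
  cond_Y : ∀ᵐ z : (Fin dx → ℝ) × (Fin dy → ℝ), f z / marginalX f z.1 < Ce
  cond_X : ∀ᵐ z : (Fin dx → ℝ) × (Fin dy → ℝ), f z / marginalY f z.2 < Ce
  marg_X : ∀ᵐ x, marginalX f x < Cf
  marg_Y : ∀ᵐ y, marginalY f y < Cf
  hausdorff_joint :
    μH[(dx : ℝ) + dy - 1] {v | ¬ SmoothAt (onJointSpace f) Cd v} ≤ ENNReal.ofReal Cg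
  hausdorff_X :
    μH[(dx : ℝ) - 1]
      {v : EuclideanSpace ℝ (Fin dx) | ¬ SmoothAt (fun w => marginalX f w.ofLp) Cd v}
      ≤ ENNReal.ofReal Ch
  hausdorff_Y :
    μH[(dy : ℝ) - 1]
      {v : EuclideanSpace ℝ (Fin dy) | ¬ SmoothAt (fun w => marginalY f w.ofLp) Cd v}
      ≤ ENNReal.ofReal Ch

/-- The standing assumption on the joint density: (a)-(h) hold with some finite constants. -/
def RateAssumption {dx dy : ℕ} (f : (Fin dx → ℝ) × (Fin dy → ℝ) → ℝ) : Prop :=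
  ∃ γ Ca Cb Cc Cd Ce Cf Cg Ch C0 : ℝ, RateConditions f γ Ca Cb Cc Cd Ce Cf Cg Ch C0

/-- The claimed rate `(log log N)² (log N)^{(2k+2)(1+δ)} / N`. -/
def varianceRate (k : ℕ) (δ : ℝ) (N : ℕ) : ℝ :=
  Real.log (Real.log N) ^ 2 * Real.log N ^ ((2 * (k : ℝ) + 2) * (1 + δ)) / N

end KSG

end

noncomputable section

namespace KSG

/-! The variance of a function of `N` independent variables is at most `N c²` if changing one
variable changes the function by at most `c` (`variance_pi_le_of_bounded_differences`). So it is
enough that moving one sample point changes the sum of the local estimates by `O(log N)`, which is a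
deterministic fact (`exists_abs_sum_localStat_sub_le`). The variance is then `O((log N)² / N)`,
within the claimed rate.

Suppose that the point `i` moves. The estimate at `j ≠ i` changes only if `i` lies, before or after
the move, in one of the balls around `j`. If `i` is critical for the nearest neighbour distance of
`j`, the estimate may change by `O(log N)`. Otherwise that distance is unchanged, each marginal
count changes by at most one, and the estimate changes by about the reciprocal of the counts
(`abs_localStat_sub_le`).

It remains to sum over `j`. Cover the space by finitely many narrow cones with apex at the point
`i`. If `l` and `j` are in one cone and `l` is no farther from `i`, then `l` is at least as close to
`j` as `i` is, so a ball around `j` that contains `i` also contains `l`. Within a cone, the counts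
therefore dominate the ranks by distance from `i`. Hence `i` is critical for `O(k)` indices, and the
reciprocals add up to a harmonic sum `O(log N)` (`exists_sum_influence_le`). -/

/-! ### A covering of a finite-dimensional normed space by narrow cones -/

/-- A finite-dimensional normed space is a finite union of cones in which the distance between
two vectors is at most the larger of their norms. -/
lemma exists_cone_coloring (V : Type*) [NormedAddCommGroup V] [NormedSpace ℝ V]
    [FiniteDimensional ℝ V] :
    ∃ (s : Finset V) (c : V → V), (∀ u, c u ∈ s) ∧
      ∀ u v, c u = c v → ‖u‖ ≤ ‖v‖ → ‖u - v‖ ≤ ‖v‖ := by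
  have : ProperSpace V := FiniteDimensional.proper_real V
  obtain ⟨t, -, htf, ht⟩ := finite_cover_balls_of_compact
    (isCompact_closedBall (0 : V) 1) (e := 1 / 2) (by norm_num)
  -- The colour of `u` is a centre near its direction. Radius 1/2 puts two directions of one colour
  -- at distance at most 1. The whole ball is covered, not just the sphere, because `u = 0`
  -- normalizes to 0.
  have hw : ∀ u : V, ∃ a ∈ t, ‖‖u‖⁻¹ • u - a‖ < 1 / 2 := by
    intro u
    have : ‖u‖⁻¹ • u ∈ Metric.closedBall (0 : V) 1 := by
      rw [mem_closedBall_zero_iff, norm_smul, norm_inv, norm_norm]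
      exact inv_mul_le_one
    simpa [dist_eq_norm] using ht this
  choose c hct hc using hw
  refine ⟨htf.toFinset, c, fun u => by simpa using hct u, fun u v huv hle => ?_⟩
  have hdec : ∀ u : V, u = ‖u‖ • (‖u‖⁻¹ • u) := by
    intro u
    by_cases h : u = 0
    · simp [h]
    · rw [smul_smul, mul_inv_cancel₀ (norm_ne_zero_iff.mpr h), one_smul]
  set a := ‖u‖⁻¹ • u with ha
  set b := ‖v‖⁻¹ • v with hb
  have hab : ‖a - b‖ ≤ 1 := by
    have h1 := hc u
    have h2 := hc v
    rw [← huv] at h2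
    have h3 := norm_sub_le (a - c u) (b - c u)
    rw [sub_sub_sub_cancel_right] at h3
    linarith
  have hb1 : ‖b‖ ≤ 1 := by
    rw [hb, norm_smul, norm_inv, norm_norm]
    exact inv_mul_le_one
  -- A change of direction costs at most `‖u‖` and a change of length `‖v‖ - ‖u‖`; together they
  -- cost `‖v‖`.
  have key : u - v = ‖u‖ • (a - b) + (‖u‖ - ‖v‖) • b := by
    rw [smul_sub, sub_smul, ← hdec u, ← hdec v]; abel
  calc ‖u - v‖ ≤ ‖u‖ * ‖a - b‖ + |‖u‖ - ‖v‖| * ‖b‖ := by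
        rw [key]
        refine (norm_add_le _ _).trans ?_
        rw [norm_smul, norm_smul, norm_norm, Real.norm_eq_abs]
    _ ≤ ‖u‖ * 1 + |‖u‖ - ‖v‖| * 1 := by gcongr
    _ = ‖v‖ := by rw [abs_of_nonpos (by linarith)]; ring

/-- If every index `j` of a finite family contained in one cone has at least as many neighbours
within `‖v j‖` as counted in `m j`, then the values `h (m j)` of an antitone `h` sum to at most
`h 0 + ⋯ + h (#s - 1)`. -/
lemma sum_le_sum_range_of_ranks {ι : Type*} [DecidableEq ι] (r : ι → ℝ) (m : ι → ℕ)
    (h : ℕ → ℝ) (hh : Antitone h) (s : Finset ι)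
    (hm : ∀ j ∈ s, ∀ t ⊆ s, j ∉ t → (∀ l ∈ t, r l ≤ r j) → t.card ≤ m j) :
    ∑ j ∈ s, h (m j) ≤ ∑ p ∈ Finset.range s.card, h p := by
  -- Remove the element of largest `r`: all the others count as its neighbours, so its `m` is at
  -- least their number.
  induction s using Finset.induction_on_max_value r with
  | empty => simp
  | insert a s ha hmax ih =>
    rw [Finset.sum_insert ha, Finset.card_insert_of_notMem ha, Finset.sum_range_succ, add_comm]
    refine add_le_add (ih fun j hj t ht => hm j (Finset.mem_insert_of_mem hj) t
      (ht.trans (Finset.subset_insert _ _))) (hh ?_)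
    exact hm a (Finset.mem_insert_self _ _) s (Finset.subset_insert _ _) ha hmax

/-- A sum over points around the origin, each weighted according to the number of other points that
are closer to it than the origin is. -/
lemma exists_sum_neighbour_rank_le (V : Type*) [NormedAddCommGroup V] [NormedSpace ℝ V]
    [FiniteDimensional ℝ V] :
    ∃ M : ℕ, ∀ {ι : Type} [DecidableEq ι] (v : ι → V) (m : ι → ℕ) (h : ℕ → ℝ)
      (_ : Antitone h) (_ : ∀ p, 0 ≤ h p) (s : Finset ι)
      (_ : ∀ j ∈ s, ∀ t ⊆ s, j ∉ t → (∀ l ∈ t, ‖v l - v j‖ ≤ ‖v j‖) → t.card ≤ m j),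
      ∑ j ∈ s, h (m j) ≤ M * ∑ p ∈ Finset.range s.card, h p := by
  classical
  obtain ⟨S, c, hcS, hc⟩ := exists_cone_coloring V
  refine ⟨S.card, fun {ι} _ v m h hh h0 s hm => ?_⟩
  rw [← Finset.sum_fiberwise_of_maps_to (g := fun j => c (v j)) (t := S) (fun j _ => hcS _)]
  rw [← nsmul_eq_mul]
  refine Finset.sum_le_card_nsmul _ _ _ fun b _ => ?_
  refine (sum_le_sum_range_of_ranks (fun j => ‖v j‖) m h hh _ ?_).trans ?_
  · intro j hj t ht hjt hle
    rw [Finset.mem_filter] at hj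
    refine hm j hj.1 t (ht.trans (Finset.filter_subset _ _)) hjt fun l hl => ?_
    exact hc _ _ ((Finset.mem_filter.mp (ht hl)).2.trans hj.2.symm) (hle l hl)
  · exact Finset.sum_le_sum_of_subset_of_nonneg
      (Finset.range_mono (Finset.card_le_card (Finset.filter_subset _ _))) fun p _ _ => h0 p

/-! ### The variance of a function with bounded differences -/

/-- Law of total variance: the mean of the conditional variances is at most `V`, and the conditional
mean `H` stays within `c` of one of its values. -/
lemma variance_prod_le {E E' : Type*} [MeasurableSpace E] [MeasurableSpace E']
    (ν : Measure E) [IsProbabilityMeasure ν] (ν' : Measure E') [IsProbabilityMeasure ν']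
    {G : E × E' → ℝ} (hG : Measurable G) {B c V : ℝ} (hB : ∀ z, |G z| ≤ B)
    (hc : ∀ a a' b, |G (a, b) - G (a', b)| ≤ c)
    (hV : ∀ a, variance (fun b => G (a, b)) ν' ≤ V) :
    variance G (ν.prod ν') ≤ c ^ 2 + V := by
  have hGa : ∀ a, Measurable fun b => G (a, b) := fun a => hG.comp measurable_prodMk_left
  have hL : ∀ a, MemLp (fun b => G (a, b)) 2 ν' := fun a =>
    MemLp.of_bound (hGa a).aestronglyMeasurable B (ae_of_all _ fun b => hB _)
  have hI : ∀ a, Integrable (fun b => G (a, b)) ν' := fun a => (hL a).integrable (by norm_num)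
  have hLp : MemLp G 2 (ν.prod ν') :=
    MemLp.of_bound hG.aestronglyMeasurable B (ae_of_all _ fun b => hB _)
  set H : E → ℝ := fun a => ∫ b, G (a, b) ∂ν' with hH
  have hHm : StronglyMeasurable H := hG.stronglyMeasurable.integral_prod_right'
  have hHB : ∀ a, |H a| ≤ B := fun a => by
    have := norm_integral_le_of_norm_le_const (μ := ν') (f := fun b => G (a, b)) (C := B)
      (ae_of_all _ fun b => hB _)
    simpa using this
  have hHL : MemLp H 2 ν := MemLp.of_bound hHm.aestronglyMeasurable B (ae_of_all _ hHB)
  obtain ⟨a₀⟩ : Nonempty E := ν.nonempty_of_neZero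
  have hHc : ∀ a, |H a - H a₀| ≤ c := fun a => by
    rw [hH]
    simp only
    rw [← integral_sub (hI a) (hI a₀)]
    have := norm_integral_le_of_norm_le_const (μ := ν')
      (f := fun b => G (a, b) - G (a₀, b)) (C := c) (ae_of_all _ fun b => hc _ _ _)
    simpa using this
  have hvarH : variance H ν ≤ c ^ 2 := by
    -- An interval of length `2c` bounds the variance by `(2c/2)² = c²`.
    refine (variance_le_sq_of_bounded (a := H a₀ - c) (b := H a₀ + c)
      (ae_of_all _ fun a => ?_) hHm.aestronglyMeasurable.aemeasurable).trans (le_of_eq (by ring))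
    have := abs_le.mp (hHc a)
    constructor <;> linarith
  rw [variance_eq_sub hLp]
  rw [variance_eq_sub hHL] at hvarH
  have h1 : ∫ z, G z ∂(ν.prod ν') = ∫ a, H a ∂ν := integral_prod _ (hLp.integrable (by norm_num))
  have h2 : ∫ z, (G ^ 2) z ∂(ν.prod ν') ≤ ∫ a, (V + (H ^ 2) a) ∂ν := by
    have hG2 : Integrable (G ^ 2) (ν.prod ν') := hLp.integrable_sq
    rw [integral_prod _ hG2]
    refine integral_mono hG2.integral_prod_left
      ((integrable_const V).add hHL.integrable_sq) fun a => ?_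
    have := hV a
    rw [variance_eq_sub (hL a)] at this
    simp only [Pi.pow_apply] at this ⊢
    linarith
  have h3 : ∫ a, (V + (H ^ 2) a) ∂ν = ∫ _, V ∂ν + ∫ a, (H ^ 2) a ∂ν :=
    integral_add (integrable_const V) hHL.integrable_sq
  rw [h3] at h2
  simp only [integral_const, probReal_univ, one_smul] at h2
  rw [h1]
  linarith

/-- If changing one coordinate changes `F` by at most `c`, then the variance of `F` under a product
probability measure with `n` factors is at most `n c²`. -/
lemma variance_pi_le_of_bounded_differences {E : Type*} [MeasurableSpace E]
    (ν : Measure E) [IsProbabilityMeasure ν] {n : ℕ} {F : (Fin n → E) → ℝ} (hF : Measurable F)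
    {B c : ℝ} (hB : ∀ z, |F z| ≤ B)
    (hc : ∀ i z z', (∀ l, l ≠ i → z l = z' l) → |F z - F z'| ≤ c) :
    variance F (Measure.pi fun _ => ν) ≤ n * c ^ 2 := by
  induction n with
  | zero =>
    have : F = fun _ => F default := funext fun z => congrArg F (Subsingleton.elim _ _)
    rw [this, variance_eq_sub (memLp_const _)]
    simp
  | succ n ih =>
    have hmp := measurePreserving_piFinSuccAbove (fun _ : Fin (n + 1) => ν) 0
    set e := MeasurableEquiv.piFinSuccAbove (fun _ : Fin (n + 1) => E) 0
    have hsymm : ∀ a b, e.symm (a, b) = Fin.cons a b := fun a b => by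
      rw [MeasurableEquiv.piFinSuccAbove_symm_apply]; simp [Fin.consEquiv]
    have hvar : variance F (Measure.pi fun _ => ν) =
        variance (F ∘ e.symm) (ν.prod (Measure.pi fun _ : Fin n => ν)) := by
      have h := variance_map_equiv (μ := ν.prod (Measure.pi fun _ : Fin n => ν)) F e.symm
      rw [hmp.symm.map_eq] at h
      exact h
    rw [hvar]
    refine (variance_prod_le ν _ (B := B) (c := c) (V := n * c ^ 2)
      (hF.comp e.symm.measurable) (fun z => hB _) (fun a a' b => ?_)
      fun a => ?_).trans (le_of_eq (by push_cast; ring))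
    · refine hc 0 _ _ fun l hl => ?_
      rw [hsymm, hsymm]
      obtain ⟨l, rfl⟩ := Fin.exists_succ_eq.mpr hl
      simp
    · refine ih (F := fun b => F (e.symm (a, b)))
        (hF.comp (e.symm.measurable.comp measurable_prodMk_left)) (fun z => hB _) ?_
      intro i z z' hz
      refine hc i.succ _ _ fun l hl => ?_
      rw [hsymm, hsymm]
      induction l using Fin.cases with
      | zero => simp
      | succ l => simpa using hz l fun h => hl (congrArg _ h)

/-! ### Neighbour counts and nearest neighbour distances of a matrix of distances -/

open Classical in
/-- The number of indices `l ≠ j` with `D l j ≤ r`. -/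
def nbrCount {N : ℕ} (D : Fin N → Fin N → ℝ) (j : Fin N) (r : ℝ) : ℕ :=
  (Finset.univ.filter fun l => l ≠ j ∧ D l j ≤ r).card

open Classical in
/-- The number of indices `l` other than `i` and `j` with `D l j ≤ r`. -/
def nbrCountExcept {N : ℕ} (D : Fin N → Fin N → ℝ) (i j : Fin N) (r : ℝ) : ℕ :=
  (Finset.univ.filter fun l => l ≠ i ∧ l ≠ j ∧ D l j ≤ r).card

lemma ncard_eq_nbrCount {N : ℕ} (D : Fin N → Fin N → ℝ) (j : Fin N) (r : ℝ) :
    Set.ncard {l : Fin N | l ≠ j ∧ D l j ≤ r} = nbrCount D j r := by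
  classical
  rw [Set.ncard_eq_toFinset_card', Set.toFinset_ofPred, nbrCount]

lemma nbrCount_le {N : ℕ} (D : Fin N → Fin N → ℝ) (j : Fin N) (r : ℝ) :
    nbrCount D j r ≤ N := by
  classical
  exact (Finset.card_le_univ _).trans (by simp)

lemma nbrCount_mono {N : ℕ} (D : Fin N → Fin N → ℝ) (j : Fin N) : Monotone (nbrCount D j) := by
  classical
  intro r r' h
  exact Finset.card_le_card fun l => by
    simp only [Finset.mem_filter]
    exact fun hl => ⟨hl.1, hl.2.1, hl.2.2.trans h⟩

lemma nbrCount_le_nbrCount {N : ℕ} {D D' : Fin N → Fin N → ℝ} (h : ∀ l j, D' l j ≤ D l j)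
    (j : Fin N) (r : ℝ) : nbrCount D j r ≤ nbrCount D' j r := by
  classical
  exact Finset.card_le_card fun l => by
    simp only [Finset.mem_filter]
    exact fun hl => ⟨hl.1, hl.2.1, (h l j).trans hl.2.2⟩

-- Splits off the moved index; the remaining count does not see the move (`nbrCountExcept_congr`).
open Classical in
lemma nbrCount_eq_add {N : ℕ} (D : Fin N → Fin N → ℝ) {i j : Fin N} (hij : i ≠ j) (r : ℝ) :
    nbrCount D j r = nbrCountExcept D i j r + if D i j ≤ r then 1 else 0 := by
  rw [nbrCount, nbrCountExcept]
  split_ifs with h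
  · rw [← Finset.card_insert_of_notMem (a := i) (by simp)]
    congr 1
    ext l
    simp only [Finset.mem_filter, Finset.mem_univ, true_and, Finset.mem_insert]
    by_cases hl : l = i
    · subst hl; simp [hij, h]
    · simp [hl]
  · rw [add_zero]
    congr 1
    ext l
    simp only [Finset.mem_filter, Finset.mem_univ, true_and]
    by_cases hl : l = i
    · subst hl; simp [h]
    · simp [hl]

lemma nbrCountExcept_congr {N : ℕ} {D D' : Fin N → Fin N → ℝ} {i : Fin N}
    (h : ∀ l j, l ≠ i → j ≠ i → D l j = D' l j) {j : Fin N} (hj : j ≠ i) (r : ℝ) :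
    nbrCountExcept D i j r = nbrCountExcept D' i j r := by
  classical
  rw [nbrCountExcept, nbrCountExcept]
  congr 1
  ext l
  simp only [Finset.mem_filter, Finset.mem_univ, true_and]
  exact and_congr_right fun hl => by rw [h l j hl hj]

/-- The distance from the index `j` to its `k`-th nearest neighbour. -/
def kthDist {N : ℕ} (k : ℕ) (D : Fin N → Fin N → ℝ) (j : Fin N) : ℝ :=
  sInf {r : ℝ | k ≤ nbrCount D j r}

/-- The infimum is attained, since the set of admissible radii is closed, nonempty (`k < N`) and
bounded below (`1 ≤ k`). Later comparisons of nearest neighbour distances go through this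
equivalence. -/
lemma kthDist_le_iff {N k : ℕ} (hk : 1 ≤ k) (hN : k < N) {D : Fin N → Fin N → ℝ}
    (hD : ∀ l j, 0 ≤ D l j) (j : Fin N) (r : ℝ) :
    kthDist k D j ≤ r ↔ k ≤ nbrCount D j r := by
  classical
  set S := {r : ℝ | k ≤ nbrCount D j r} with hS
  have hbdd : BddBelow S := ⟨0, fun r hr => by
    by_contra hlt
    have : nbrCount D j r = 0 := by
      rw [nbrCount, Finset.card_eq_zero, Finset.filter_eq_empty_iff]
      rintro l - ⟨-, hl⟩
      exact hlt ((hD l j).trans hl)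
    rw [hS, Set.mem_ofPred_eq, this] at hr
    omega⟩
  have hne : S.Nonempty := by
    refine ⟨∑ l, D l j, ?_⟩
    have : nbrCount D j (∑ l, D l j) = N - 1 := by
      rw [nbrCount, Finset.filter_congr (q := fun l => l ≠ j), Finset.filter_ne',
        Finset.card_erase_of_mem (Finset.mem_univ _), Finset.card_univ, Fintype.card_fin]
      intro l _
      exact and_iff_left (Finset.single_le_sum (f := fun l => D l j)
        (fun l _ => hD l j) (Finset.mem_univ l))
    rw [hS, Set.mem_ofPred_eq, this]
    omega
  have hclosed : IsClosed S := by
    -- A radius is admissible when it reaches all of some set `T` of at least `k` indices; there are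
    -- finitely many such sets.
    have : S = ⋃ T ∈ {T : Finset (Fin N) | k ≤ T.card ∧ j ∉ T}, {r | ∀ l ∈ T, D l j ≤ r} := by
      ext r
      simp only [hS, Set.mem_ofPred_eq, Set.mem_iUnion, exists_prop]
      constructor
      · intro h
        exact ⟨_, ⟨h, by simp⟩, fun l hl => (Finset.mem_filter.mp hl).2.2⟩
      · rintro ⟨T, ⟨hT, hjT⟩, h⟩
        refine hT.trans (Finset.card_le_card fun l hl => ?_)
        rw [Finset.mem_filter]
        exact ⟨Finset.mem_univ _, fun h => hjT (h ▸ hl), h l hl⟩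
    rw [this]
    refine Set.Finite.isClosed_biUnion (Set.toFinite _) fun T _ => ?_
    simp only [Set.ofPred_forall]
    exact isClosed_biInter fun l _ => isClosed_Ici
  constructor
  · intro h
    have hmem : k ≤ nbrCount D j (kthDist k D j) := hclosed.csInf_mem hne hbdd
    exact hmem.trans (nbrCount_mono D j h)
  · exact fun h => csInf_le hbdd h

/-- Changing the matrix at the index `i` does not increase the `k`-th nearest neighbour distance of
`j`, unless `i` is within that distance together with fewer than `k` others. -/
lemma kthDist_le_of_not_critical {N k : ℕ} (hk : 1 ≤ k) (hN : k < N) {D D' : Fin N → Fin N → ℝ}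
    (hD : ∀ l j, 0 ≤ D l j) (hD' : ∀ l j, 0 ≤ D' l j) {i j : Fin N} (hij : i ≠ j)
    (h : ∀ l j, l ≠ i → j ≠ i → D l j = D' l j)
    (hc : ¬ (D i j ≤ kthDist k D j ∧ nbrCountExcept D i j (kthDist k D j) < k)) :
    kthDist k D' j ≤ kthDist k D j := by
  rw [kthDist_le_iff hk hN hD', nbrCount_eq_add _ hij, ← nbrCountExcept_congr h hij.symm]
  have h1 := (kthDist_le_iff hk hN hD j _).mp le_rfl
  rw [nbrCount_eq_add _ hij] at h1
  -- If `i` is in the ball, `k` unmoved points are there as well; if not, all the points counted are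
  -- unmoved.
  by_cases h2 : D i j ≤ kthDist k D j
  · have := not_lt.mp fun h3 => hc ⟨h2, h3⟩
    omega
  · rw [if_neg h2] at h1
    omega

/-! ### The sensitivity of the local estimates to one sample point -/

open Classical in
/-- The common form of the local information estimates. -/
def localStat {N : ℕ} (k : ℕ) (c t : ℝ) (g : ℕ → ℝ) (D Dx Dy : Fin N → Fin N → ℝ) (j : Fin N) :
    ℝ :=
  if kthDist k D j ≤ t then
    c - g (nbrCount Dx j (kthDist k D j)) - g (nbrCount Dy j (kthDist k D j)) else 0

open Classical in
/-- The value of `h` at the number of points which are at most as far from `j` as `r`, if `i` is one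
of them. -/
def influence {N : ℕ} (h : ℕ → ℝ) (D : Fin N → Fin N → ℝ) (i j : Fin N) (r : ℝ) : ℝ :=
  if D i j ≤ r then h (nbrCountExcept D i j r) else 0

/-- The weight of a change of a nearest neighbour distance. -/
def critWeight (k : ℕ) (p : ℕ) : ℝ := if p < k then 1 else 0

/-- The weight of a change of a count by one. -/
def logWeight (p : ℕ) : ℝ := 1 / max 1 (p : ℝ)

lemma critWeight_nonneg (k p : ℕ) : 0 ≤ critWeight k p := by
  rw [critWeight]; split_ifs <;> norm_num

lemma logWeight_nonneg (p : ℕ) : 0 ≤ logWeight p := by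
  rw [logWeight]; positivity

lemma critWeight_antitone (k : ℕ) : Antitone (critWeight k) := by
  intro p q h
  rw [critWeight, critWeight]
  split_ifs with h1 h2
  · exact le_rfl
  · exact absurd (h.trans_lt h1) h2
  · exact zero_le_one
  · exact le_rfl

lemma logWeight_antitone : Antitone logWeight := by
  intro p q h
  rw [logWeight, logWeight]
  gcongr

lemma sum_critWeight_le (k n : ℕ) : ∑ p ∈ Finset.range n, critWeight k p ≤ k := by
  simp only [critWeight]
  rw [Finset.sum_boole]
  have : ((Finset.range n).filter fun p => p < k) ⊆ Finset.range k := fun p hp => by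
    simpa using (Finset.mem_filter.mp hp).2
  exact_mod_cast (Finset.card_le_card this).trans (by simp)

/-- The term `p = 0` gives 1 and the rest is a harmonic sum. -/
lemma sum_logWeight_le (n : ℕ) : ∑ p ∈ Finset.range n, logWeight p ≤ 2 + Real.log n := by
  cases n with
  | zero => simp
  | succ n =>
    rw [Finset.sum_range_succ']
    have h1 : ∑ p ∈ Finset.range n, logWeight (p + 1) = (harmonic n : ℝ) := by
      rw [harmonic]
      push_cast
      refine Finset.sum_congr rfl fun p _ => ?_
      rw [logWeight, max_eq_right (by push_cast; linarith [(Nat.cast_nonneg p : (0 : ℝ) ≤ p)])]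
      push_cast
      rw [one_div]
    have h2 := harmonic_le_one_add_log n
    have h3 : Real.log n ≤ Real.log (n + 1 : ℕ) := by
      rcases Nat.eq_zero_or_pos n with rfl | hn
      · simp
      · exact Real.log_le_log (by exact_mod_cast hn) (by push_cast; linarith)
    have h4 : logWeight 0 = 1 := by simp [logWeight]
    rw [h1, h4]
    linarith

/-- Passing to a marginal does not increase distances, so the marginal counts are at least `k ≥ 1`,
and `g` is only evaluated between 1 and `N`. -/
lemma abs_localStat_le {N k : ℕ} (hk : 1 ≤ k) (hN : k < N) {D Dx Dy : Fin N → Fin N → ℝ}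
    (hD : ∀ l j, 0 ≤ D l j) (hx : ∀ l j, Dx l j ≤ D l j) (hy : ∀ l j, Dy l j ≤ D l j)
    {c t B : ℝ} {g : ℕ → ℝ} (hc : |c| ≤ B) (hg : ∀ n, 1 ≤ n → n ≤ N → |g n| ≤ B) (j : Fin N) :
    |localStat k c t g D Dx Dy j| ≤ 3 * B := by
  have hB : 0 ≤ B := (abs_nonneg c).trans hc
  rw [localStat]
  split_ifs
  · have h := (kthDist_le_iff hk hN hD j _).mp le_rfl
    have h1 := hg _ (hk.trans (h.trans (nbrCount_le_nbrCount hx j _))) (nbrCount_le _ _ _)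
    have h2 := hg _ (hk.trans (h.trans (nbrCount_le_nbrCount hy j _))) (nbrCount_le _ _ _)
    rw [abs_le] at *
    constructor <;> linarith
  · simp [hB]

/-- The effect on `g` of moving the index `i` on a count that stays positive. -/
lemma abs_sub_count_le {N : ℕ} {D D' : Fin N → Fin N → ℝ} {i j : Fin N} (hij : i ≠ j)
    (h : ∀ l j, l ≠ i → j ≠ i → D l j = D' l j) {r : ℝ} {g : ℕ → ℝ}
    (hg : ∀ n : ℕ, 1 ≤ n → |g (n + 1) - g n| ≤ 1 / n)
    (h1 : 1 ≤ nbrCount D j r) (h2 : 1 ≤ nbrCount D' j r) :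
    |g (nbrCount D j r) - g (nbrCount D' j r)| ≤
      influence logWeight D i j r + influence logWeight D' i j r := by
  have hw : ∀ n : ℕ, 1 ≤ n → |g (n + 1) - g n| ≤ logWeight n := fun n hn => by
    rw [logWeight, max_eq_right (by exact_mod_cast hn)]
    exact hg n hn
  rw [nbrCount_eq_add _ hij] at h1 h2 ⊢
  rw [nbrCount_eq_add _ hij, influence, influence]
  rw [← nbrCountExcept_congr h hij.symm] at h2 ⊢
  set m := nbrCountExcept D i j r
  have h0 := logWeight_nonneg m
  -- The counts are `m` or `m + 1`. If they differ, the smaller one is `m`, so `1 ≤ m` and `hg`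
  -- applies at `m`.
  split_ifs at h1 h2 ⊢ with ha hb hb
  · simp only [sub_self, abs_zero]; linarith
  · simpa using hw m h2
  · rw [abs_sub_comm]; simpa using hw m h1
  · simp

/-- If `i` is critical for `j` before or after the move, `critWeight` pays for the trivial bound `6
* B`. Otherwise `kthDist_le_of_not_critical`, used in both directions, shows that the radius is
unchanged; the truncation then takes the same branch, and `logWeight` pays for the two counts. -/
lemma abs_localStat_sub_le {N k : ℕ} (hk : 1 ≤ k) (hN : k < N)
    {D Dx Dy D' Dx' Dy' : Fin N → Fin N → ℝ} {i j : Fin N} (hij : i ≠ j)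
    (hD : ∀ l j, 0 ≤ D l j) (hx : ∀ l j, Dx l j ≤ D l j) (hy : ∀ l j, Dy l j ≤ D l j)
    (hD' : ∀ l j, 0 ≤ D' l j) (hx' : ∀ l j, Dx' l j ≤ D' l j) (hy' : ∀ l j, Dy' l j ≤ D' l j)
    (e : ∀ l j, l ≠ i → j ≠ i → D l j = D' l j) (ex : ∀ l j, l ≠ i → j ≠ i → Dx l j = Dx' l j)
    (ey : ∀ l j, l ≠ i → j ≠ i → Dy l j = Dy' l j)
    {c t B : ℝ} {g : ℕ → ℝ} (hc : |c| ≤ B) (hg : ∀ n, 1 ≤ n → n ≤ N → |g n| ≤ B)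
    (hg' : ∀ n : ℕ, 1 ≤ n → |g (n + 1) - g n| ≤ 1 / n) :
    |localStat k c t g D Dx Dy j - localStat k c t g D' Dx' Dy' j| ≤
      (6 * B * influence (critWeight k) D i j (kthDist k D j) +
        influence logWeight Dx i j (kthDist k D j) +
        influence logWeight Dy i j (kthDist k D j)) +
      (6 * B * influence (critWeight k) D' i j (kthDist k D' j) +
        influence logWeight Dx' i j (kthDist k D' j) +
        influence logWeight Dy' i j (kthDist k D' j)) := by
  have hB : 0 ≤ B := (abs_nonneg c).trans hc
  have hI : ∀ {h : ℕ → ℝ}, (∀ p, 0 ≤ h p) → ∀ (D : Fin N → Fin N → ℝ) r,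
      0 ≤ influence h D i j r := fun h0 D r => by
    rw [influence]; split_ifs <;> simp [h0]
  have c1 := hI (critWeight_nonneg k) D (kthDist k D j)
  have c2 := hI (critWeight_nonneg k) D' (kthDist k D' j)
  have l1 := hI logWeight_nonneg Dx (kthDist k D j)
  have l2 := hI logWeight_nonneg Dy (kthDist k D j)
  have l3 := hI logWeight_nonneg Dx' (kthDist k D' j)
  have l4 := hI logWeight_nonneg Dy' (kthDist k D' j)
  have hcrit : ∀ D : Fin N → Fin N → ℝ,
      D i j ≤ kthDist k D j ∧ nbrCountExcept D i j (kthDist k D j) < k →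
      influence (critWeight k) D i j (kthDist k D j) = 1 := fun D h => by
    rw [influence, if_pos h.1, critWeight, if_pos h.2]
  have hbig : |localStat k c t g D Dx Dy j - localStat k c t g D' Dx' Dy' j| ≤ 6 * B := by
    have a1 := abs_localStat_le (t := t) hk hN hD hx hy hc hg j
    have a2 := abs_localStat_le (t := t) hk hN hD' hx' hy' hc hg j
    exact (abs_sub _ _).trans (by linarith)
  have p1 := mul_nonneg hB c1
  have p2 := mul_nonneg hB c2
  by_cases h1 : D i j ≤ kthDist k D j ∧ nbrCountExcept D i j (kthDist k D j) < k
  · rw [hcrit D h1]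
    linarith
  by_cases h2 : D' i j ≤ kthDist k D' j ∧ nbrCountExcept D' i j (kthDist k D' j) < k
  · rw [hcrit D' h2]
    linarith
  have heq : kthDist k D' j = kthDist k D j :=
    le_antisymm (kthDist_le_of_not_critical hk hN hD hD' hij e h1)
      (kthDist_le_of_not_critical hk hN hD' hD hij (fun l j hl hj => (e l j hl hj).symm) h2)
  have n1 := hk.trans ((kthDist_le_iff hk hN hD j _).mp le_rfl)
  have n2 := hk.trans ((kthDist_le_iff hk hN hD' j _).mp le_rfl)
  rw [heq] at n2 c2 l3 l4 p2 ⊢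
  have gx := abs_sub_count_le hij ex hg' (n1.trans (nbrCount_le_nbrCount hx j _))
    (n2.trans (nbrCount_le_nbrCount hx' j _))
  have gy := abs_sub_count_le hij ey hg' (n1.trans (nbrCount_le_nbrCount hy j _))
    (n2.trans (nbrCount_le_nbrCount hy' j _))
  rw [localStat, localStat, heq]
  split_ifs
  · rw [abs_le] at gx gy ⊢
    constructor <;> linarith
  · simp only [sub_self, abs_zero]; linarith

/-- The distance matrix of a finite family of points. -/
def normDist {V : Type*} [NormedAddCommGroup V] {N : ℕ} (P : Fin N → V) (l j : Fin N) : ℝ :=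
  ‖P l - P j‖

/-- The cone estimate with the origin moved to `P i`. The radii are arbitrary because the marginal
counts use radii that come from the joint space. -/
lemma exists_sum_influence_le (V : Type*) [NormedAddCommGroup V] [NormedSpace ℝ V]
    [FiniteDimensional ℝ V] :
    ∃ M : ℕ, ∀ {N : ℕ} (P : Fin N → V) (h : ℕ → ℝ) (_ : Antitone h) (_ : ∀ p, 0 ≤ h p)
      (i : Fin N) (r : Fin N → ℝ),
      ∑ j ∈ Finset.univ.erase i, influence h (normDist P) i j (r j) ≤
        M * ∑ p ∈ Finset.range N, h p := by
  classical
  obtain ⟨M, hM⟩ := exists_sum_neighbour_rank_le V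
  refine ⟨M, fun {N} P h hh h0 i r => ?_⟩
  simp only [influence]
  rw [← Finset.sum_filter]
  refine (hM (fun j => P j - P i) (fun j => nbrCountExcept (normDist P) i j (r j)) h hh h0 _
    ?_).trans ?_
  · intro j hj t ht hjt hle
    simp only [Finset.mem_filter, Finset.mem_erase, Finset.mem_univ, and_true] at hj
    refine Finset.card_le_card fun l hl => ?_
    have hl' := ht hl
    simp only [Finset.mem_filter, Finset.mem_erase, Finset.mem_univ, and_true, true_and] at hl' ⊢
    refine ⟨hl'.1, fun h => hjt (h ▸ hl), ?_⟩
    have := hle l hl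
    rw [sub_sub_sub_cancel_right, norm_sub_rev (P j)] at this
    exact this.trans hj.2
  · refine mul_le_mul_of_nonneg_left ?_ (Nat.cast_nonneg _)
    refine Finset.sum_le_sum_of_subset_of_nonneg (Finset.range_mono ?_) fun p _ _ => h0 p
    exact (Finset.card_le_univ _).trans (by simp)

/-- Moving one of the `N` sample points changes the sum of the local estimates by
`O(B + log N)`. -/
lemma exists_abs_sum_localStat_sub_le (V Vx Vy : Type*)
    [NormedAddCommGroup V] [NormedSpace ℝ V] [FiniteDimensional ℝ V]
    [NormedAddCommGroup Vx] [NormedSpace ℝ Vx] [FiniteDimensional ℝ Vx]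
    [NormedAddCommGroup Vy] [NormedSpace ℝ Vy] [FiniteDimensional ℝ Vy] {k : ℕ} (hk : 1 ≤ k) :
    ∃ K : ℝ, 0 ≤ K ∧ ∀ {N : ℕ} (_ : k < N) {P P' : Fin N → V} {Px Px' : Fin N → Vx}
      {Py Py' : Fin N → Vy} {i : Fin N}
      (_ : ∀ l j, normDist Px l j ≤ normDist P l j) (_ : ∀ l j, normDist Py l j ≤ normDist P l j)
      (_ : ∀ l j, normDist Px' l j ≤ normDist P' l j)
      (_ : ∀ l j, normDist Py' l j ≤ normDist P' l j)
      (_ : ∀ l, l ≠ i → P l = P' l) (_ : ∀ l, l ≠ i → Px l = Px' l) (_ : ∀ l, l ≠ i → Py l = Py' l)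
      {c t B : ℝ} {g : ℕ → ℝ} (_ : |c| ≤ B) (_ : ∀ n, 1 ≤ n → n ≤ N → |g n| ≤ B)
      (_ : ∀ n : ℕ, 1 ≤ n → |g (n + 1) - g n| ≤ 1 / n),
      |∑ j, localStat k c t g (normDist P) (normDist Px) (normDist Py) j -
        ∑ j, localStat k c t g (normDist P') (normDist Px') (normDist Py') j| ≤
      K * (B + 2 + Real.log N) := by
  obtain ⟨M, hM⟩ := exists_sum_influence_le V
  obtain ⟨Mx, hMx⟩ := exists_sum_influence_le Vx
  obtain ⟨My, hMy⟩ := exists_sum_influence_le Vy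
  -- The 6 is the trivial bound for the moved index itself; the other terms are the bounds of
  -- `hsum`, doubled for the positions before and after.
  refine ⟨6 + 12 * (M * k) + 2 * Mx + 2 * My, by positivity, ?_⟩
  intro N hN P P' Px Px' Py Py' i hx hy hx' hy' e ex ey c t B g hc hg hg'
  have hB : 0 ≤ B := (abs_nonneg c).trans hc
  have hnn : ∀ (P : Fin N → V) l j, 0 ≤ normDist P l j := fun P l j => norm_nonneg _
  have hlog : 0 ≤ Real.log N := Real.log_natCast_nonneg N
  have hsum : ∀ (P : Fin N → V) (Px : Fin N → Vx) (Py : Fin N → Vy) (r : Fin N → ℝ),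
      ∑ j ∈ Finset.univ.erase i, (6 * B * influence (critWeight k) (normDist P) i j (r j) +
        influence logWeight (normDist Px) i j (r j) + influence logWeight (normDist Py) i j (r j))
      ≤ 6 * B * (M * k) + Mx * (2 + Real.log N) + My * (2 + Real.log N) := by
    intro P Px Py r
    rw [Finset.sum_add_distrib, Finset.sum_add_distrib, ← Finset.mul_sum]
    refine add_le_add (add_le_add ?_ ?_) ?_
    · refine mul_le_mul_of_nonneg_left ?_ (by positivity)
      exact (hM P _ (critWeight_antitone k) (critWeight_nonneg k) i r).trans
        (mul_le_mul_of_nonneg_left (sum_critWeight_le k N) (Nat.cast_nonneg _))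
    · exact (hMx Px _ logWeight_antitone logWeight_nonneg i r).trans
        (mul_le_mul_of_nonneg_left (sum_logWeight_le N) (Nat.cast_nonneg _))
    · exact (hMy Py _ logWeight_antitone logWeight_nonneg i r).trans
        (mul_le_mul_of_nonneg_left (sum_logWeight_le N) (Nat.cast_nonneg _))
  rw [← Finset.sum_sub_distrib, ← Finset.add_sum_erase _ _ (Finset.mem_univ i)]
  have hi : |localStat k c t g (normDist P) (normDist Px) (normDist Py) i -
      localStat k c t g (normDist P') (normDist Px') (normDist Py') i| ≤ 6 * B := by
    have a1 := abs_localStat_le (t := t) hk hN (hnn P) hx hy hc hg i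
    have a2 := abs_localStat_le (t := t) hk hN (hnn P') hx' hy' hc hg i
    exact (abs_sub _ _).trans (by linarith)
  refine (abs_add_le _ _).trans ((add_le_add hi ((Finset.abs_sum_le_sum_abs _ _).trans
    (Finset.sum_le_sum fun j hj => abs_localStat_sub_le hk hN (Finset.ne_of_mem_erase hj).symm
      (hnn P) hx hy (hnn P') hx' hy' ?_ ?_ ?_ hc hg hg'))).trans ?_)
  · intro l j hl hj; rw [normDist, normDist, e l hl, e j hj]
  · intro l j hl hj; rw [normDist, normDist, ex l hl, ex j hj]
  · intro l j hl hj; rw [normDist, normDist, ey l hl, ey j hj]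
  · rw [Finset.sum_add_distrib]
    refine (add_le_add_right (add_le_add (hsum P Px Py _) (hsum P' Px' Py' _)) _).trans ?_
    have q1 : 0 ≤ (M : ℝ) * k * (2 + Real.log N) := by positivity
    have q2 : 0 ≤ (Mx : ℝ) * B := by positivity
    have q3 : 0 ≤ (My : ℝ) * B := by positivity
    nlinarith

/-! ### Measurability -/

lemma measurable_nbrCount {A : Type*} [MeasurableSpace A] {N : ℕ} {D : A → Fin N → Fin N → ℝ}
    (hD : ∀ l j, Measurable fun a => D a l j) (j : Fin N) {r : A → ℝ} (hr : Measurable r) :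
    Measurable fun a => nbrCount (D a) j (r a) := by
  classical
  simp only [nbrCount, Finset.card_filter]
  refine Finset.measurable_fun_sum _ fun l _ => ?_
  by_cases hl : l = j
  · simp [hl]
  · simp only [ne_eq, hl, not_false_eq_true, true_and]
    exact Measurable.ite (measurableSet_le (hD l j) hr) measurable_const measurable_const

lemma measurable_kthDist {A : Type*} [MeasurableSpace A] {N k : ℕ} (hk : 1 ≤ k) (hN : k < N)
    {D : A → Fin N → Fin N → ℝ} (hD : ∀ l j, Measurable fun a => D a l j)
    (h0 : ∀ a l j, 0 ≤ D a l j) (j : Fin N) :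
    Measurable fun a => kthDist k (D a) j := by
  refine measurable_of_Iic fun r => ?_
  have : (fun a => kthDist k (D a) j) ⁻¹' Set.Iic r = {a | k ≤ nbrCount (D a) j r} := by
    ext a
    exact kthDist_le_iff hk hN (h0 a) j r
  rw [this]
  exact measurableSet_le measurable_const (measurable_nbrCount hD j measurable_const)

lemma measurable_localStat {A : Type*} [MeasurableSpace A] {N k : ℕ} (hk : 1 ≤ k) (hN : k < N)
    {D Dx Dy : A → Fin N → Fin N → ℝ} (hD : ∀ l j, Measurable fun a => D a l j)
    (hDx : ∀ l j, Measurable fun a => Dx a l j) (hDy : ∀ l j, Measurable fun a => Dy a l j)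
    (h0 : ∀ a l j, 0 ≤ D a l j) (c t : ℝ) (g : ℕ → ℝ) (j : Fin N) :
    Measurable fun a => localStat k c t g (D a) (Dx a) (Dy a) j := by
  have hr := measurable_kthDist hk hN hD h0 j
  have hg : Measurable g := measurable_from_top
  exact Measurable.ite (measurableSet_le hr measurable_const)
    ((measurable_const.sub (hg.comp (measurable_nbrCount hDx j hr))).sub
      (hg.comp (measurable_nbrCount hDy j hr))) measurable_const

/-! ### The estimators in terms of distance matrices -/

/-- The points `x l` in `ℓ_p`. -/
def lpPoints {ι : Type*} {N : ℕ} (p : ℝ≥0∞) (x : Fin N → ι → ℝ) (l : Fin N) :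
    PiLp p (fun _ : ι => ℝ) :=
  WithLp.toLp p (x l)

/-- The points `(x l, y l)` in `ℓ_p`. -/
def lpJointPoints {dx dy N : ℕ} (p : ℝ≥0∞) (x : Fin N → Fin dx → ℝ) (y : Fin N → Fin dy → ℝ) :
    Fin N → PiLp p (fun _ : Fin dx ⊕ Fin dy => ℝ) :=
  lpPoints p fun l => joint (x l) (y l)

lemma countWithin_eq {d N : ℕ} (p : ℝ≥0∞) [Fact (1 ≤ p)] (x : Fin N → Fin d → ℝ) (j : Fin N)
    (r : ℝ) : countWithin p x j r = nbrCount (normDist (lpPoints p x)) j r :=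
  ncard_eq_nbrCount (normDist (lpPoints p x)) j r

lemma knnDist_eq {dx dy N : ℕ} (p : ℝ≥0∞) [Fact (1 ≤ p)] (k : ℕ) (x : Fin N → Fin dx → ℝ)
    (y : Fin N → Fin dy → ℝ) (j : Fin N) :
    knnDist p k x y j = kthDist k (normDist (lpJointPoints p x y)) j := by
  rw [kthDist]
  simp only [← ncard_eq_nbrCount]
  rfl

lemma iotaInf_eq {dx dy N : ℕ} (k : ℕ) (δ : ℝ) (x : Fin N → Fin dx → ℝ)
    (y : Fin N → Fin dy → ℝ) (j : Fin N) :
    iotaInf k δ x y j = localStat k (psi k + Real.log N) (threshold dx dy δ N)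
      (fun n => psi (n + 1)) (normDist (lpJointPoints ∞ x y)) (normDist (lpPoints ∞ x))
      (normDist (lpPoints ∞ y)) j := by
  rw [iotaInf, localStat, countWithin_eq, countWithin_eq, knnDist_eq]

lemma iotaTwo_eq {dx dy N : ℕ} (k : ℕ) (δ : ℝ) (x : Fin N → Fin dx → ℝ)
    (y : Fin N → Fin dy → ℝ) (j : Fin N) :
    iotaTwo k δ x y j = localStat k
      (psi k + Real.log N + Real.log (ballVol dx * ballVol dy / ballVol (dx + dy)))
      (threshold dx dy δ N) (fun n => Real.log n) (normDist (lpJointPoints 2 x y))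
      (normDist (lpPoints 2 x)) (normDist (lpPoints 2 y)) j := by
  rw [iotaTwo, localStat, countWithin_eq, countWithin_eq, knnDist_eq]

/-- The `ℓ_p` norms of the blocks of a vector are at most that of the vector. -/
def BlockMonotone (p : ℝ≥0∞) (dx dy : ℕ) : Prop :=
  ∀ (u u' : Fin dx → ℝ) (v v' : Fin dy → ℝ),
    lpDist p u u' ≤ lpDist p (joint u v) (joint u' v') ∧
    lpDist p v v' ≤ lpDist p (joint u v) (joint u' v')

lemma blockMonotone_two (dx dy : ℕ) : BlockMonotone 2 dx dy := by
  intro u u' v v'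
  simp only [lpDist, PiLp.norm_eq_of_L2, Fintype.sum_sum_type, joint, Pi.sub_apply, Sum.elim_inl,
    Sum.elim_inr]
  constructor <;> refine Real.sqrt_le_sqrt ?_
  · exact le_add_of_nonneg_right (Finset.sum_nonneg fun _ _ => sq_nonneg _)
  · exact le_add_of_nonneg_left (Finset.sum_nonneg fun _ _ => sq_nonneg _)

lemma blockMonotone_top (dx dy : ℕ) : BlockMonotone ∞ dx dy := by
  intro u u' v v'
  simp only [lpDist, PiLp.norm_toLp]
  constructor <;> refine (pi_norm_le_iff_of_nonneg (norm_nonneg _)).mpr fun a => ?_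
  · exact norm_le_pi_norm (joint u v - joint u' v') (Sum.inl a)
  · exact norm_le_pi_norm (joint u v - joint u' v') (Sum.inr a)

lemma measurable_normDist_lpPoints {A ι : Type*} [MeasurableSpace A] [Fintype ι] {N : ℕ}
    (p : ℝ≥0∞) [Fact (1 ≤ p)] {x : A → Fin N → ι → ℝ} (hx : Measurable x) (l j : Fin N) :
    Measurable fun a => normDist (lpPoints p (x a)) l j := by
  have hc : Continuous fun w : ι → ℝ => ‖(WithLp.toLp p w : PiLp p fun _ : ι => ℝ)‖ :=
    (PiLp.continuous_toLp p _).norm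
  have hl : Measurable fun a => x a l - x a j :=
    ((measurable_pi_apply l).comp hx).sub ((measurable_pi_apply j).comp hx)
  exact hc.measurable.comp hl

/-! ### The variance of averages of local estimates -/

/-- The average of the local estimates. -/
def averageStat {dx dy N : ℕ} (p : ℝ≥0∞) [Fact (1 ≤ p)] (k : ℕ) (c t : ℝ) (g : ℕ → ℝ)
    (z : Fin N → (Fin dx → ℝ) × (Fin dy → ℝ)) : ℝ :=
  (1 / (N : ℝ)) * ∑ j, localStat k c t g
    (normDist (lpJointPoints p (fun l => (z l).1) (fun l => (z l).2)))
    (normDist (lpPoints p fun l => (z l).1)) (normDist (lpPoints p fun l => (z l).2)) j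

lemma measurable_averageStat {dx dy N k : ℕ} (p : ℝ≥0∞) [Fact (1 ≤ p)] (hk : 1 ≤ k) (hN : k < N)
    (c t : ℝ) (g : ℕ → ℝ) :
    Measurable (averageStat (dx := dx) (dy := dy) (N := N) p k c t g) := by
  refine (Finset.measurable_fun_sum _ fun j _ => measurable_localStat hk hN
    (fun l j => measurable_normDist_lpPoints p ?_ l j)
    (fun l j => measurable_normDist_lpPoints p ?_ l j)
    (fun l j => measurable_normDist_lpPoints p ?_ l j) (fun a l j => norm_nonneg _)
    c t g j).const_mul _
  · refine measurable_pi_lambda _ fun l => measurable_pi_lambda _ fun a => ?_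
    rcases a with a | b
    · exact (measurable_pi_apply a).comp (measurable_fst.comp (measurable_pi_apply l))
    · exact (measurable_pi_apply b).comp (measurable_snd.comp (measurable_pi_apply l))
  · exact measurable_pi_lambda _ fun l => measurable_fst.comp (measurable_pi_apply l)
  · exact measurable_pi_lambda _ fun l => measurable_snd.comp (measurable_pi_apply l)

lemma abs_averageStat_le {dx dy N k : ℕ} {p : ℝ≥0∞} [Fact (1 ≤ p)] (hp : BlockMonotone p dx dy)
    (hk : 1 ≤ k) (hN : k < N) {c t B : ℝ} {g : ℕ → ℝ} (hc : |c| ≤ B)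
    (hg : ∀ n, 1 ≤ n → n ≤ N → |g n| ≤ B) (z : Fin N → (Fin dx → ℝ) × (Fin dy → ℝ)) :
    |averageStat p k c t g z| ≤ 3 * B := by
  have hN0 : (0 : ℝ) < N := by exact_mod_cast (Nat.zero_le k).trans_lt hN
  rw [averageStat, abs_mul, abs_of_pos (by positivity), one_div, inv_mul_le_iff₀ hN0]
  refine (Finset.abs_sum_le_sum_abs _ _).trans ((Finset.sum_le_card_nsmul _ _ (3 * B)
    fun j _ => abs_localStat_le hk hN (fun _ _ => norm_nonneg _) (fun l j => (hp _ _ _ _).1)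
      (fun l j => (hp _ _ _ _).2) hc hg j).trans ?_)
  simp

/-- The average has differences at most `K (B + 2 + log N) / N`, and `N` times the square of this is
the bound. The constant depends neither on `N` nor on the law. -/
lemma exists_variance_averageStat_le (dx dy : ℕ) {k : ℕ} {p : ℝ≥0∞} [Fact (1 ≤ p)]
    (hp : BlockMonotone p dx dy) (hk : 1 ≤ k) :
    ∃ K : ℝ, 0 ≤ K ∧ ∀ {N : ℕ} (_ : k < N) {c t B : ℝ} {g : ℕ → ℝ} (_ : |c| ≤ B)
      (_ : ∀ n, 1 ≤ n → n ≤ N → |g n| ≤ B)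
      (_ : ∀ n : ℕ, 1 ≤ n → |g (n + 1) - g n| ≤ 1 / n)
      (ν : Measure ((Fin dx → ℝ) × (Fin dy → ℝ))) [IsProbabilityMeasure ν],
      variance (averageStat (N := N) p k c t g) (Measure.pi fun _ => ν) ≤
        K * (B + 2 + Real.log N) ^ 2 / N := by
  obtain ⟨K, hK0, hK⟩ := exists_abs_sum_localStat_sub_le (PiLp p fun _ : Fin dx ⊕ Fin dy => ℝ)
    (PiLp p fun _ : Fin dx => ℝ) (PiLp p fun _ : Fin dy => ℝ) hk
  refine ⟨K ^ 2, sq_nonneg _, fun {N} hN {c t B g} hc hg hg' ν _ => ?_⟩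
  have hN0 : (0 : ℝ) < N := by exact_mod_cast (Nat.zero_le k).trans_lt hN
  refine (variance_pi_le_of_bounded_differences ν (measurable_averageStat p hk hN c t g)
    (B := 3 * B) (c := K * (B + 2 + Real.log N) / N) (abs_averageStat_le hp hk hN hc hg)
    ?_).trans (le_of_eq (by field_simp))
  intro i z z' h
  rw [averageStat, averageStat, ← mul_sub, abs_mul, abs_of_pos (by positivity), one_div,
    inv_mul_eq_div]
  refine div_le_div_of_nonneg_right ?_ hN0.le
  have key := hK hN (P := lpJointPoints p (fun l => (z l).1) (fun l => (z l).2))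
    (P' := lpJointPoints p (fun l => (z' l).1) (fun l => (z' l).2))
    (Px := lpPoints p fun l => (z l).1) (Px' := lpPoints p fun l => (z' l).1)
    (Py := lpPoints p fun l => (z l).2) (Py' := lpPoints p fun l => (z' l).2) (i := i)
    (fun l j => (hp _ _ _ _).1) (fun l j => (hp _ _ _ _).2)
    (fun l j => (hp _ _ _ _).1) (fun l j => (hp _ _ _ _).2)
    (fun l hl => by simp only [lpJointPoints, lpPoints, h l hl])
    (fun l hl => by simp only [lpPoints, h l hl]) (fun l hl => by simp only [lpPoints, h l hl])
    (c := c) (t := t) (B := B) (g := g) hc hg hg'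
  exact key

/-- The exponent `(2k+2)(1+δ)` is at least 2, and `log log N ≥ 1` once `log N ≥ e`. The factor 4
comes from `1 + log N ≤ 2 log N`. -/
lemma log_sq_div_isBigO_varianceRate {k : ℕ} {δ : ℝ} (hδ : 0 < δ) :
    (fun N : ℕ => (1 + Real.log N) ^ 2 / N) =O[atTop] varianceRate k δ := by
  refine IsBigO.of_bound 4 ?_
  have hlog : Tendsto (fun N : ℕ => Real.log N) atTop atTop :=
    Real.tendsto_log_atTop.comp tendsto_natCast_atTop_atTop
  filter_upwards [hlog.eventually_ge_atTop (Real.exp 1)] with N hN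
  have h1 : 1 ≤ Real.log N := (Real.one_le_exp zero_le_one).trans hN
  have h2 : 1 ≤ Real.log (Real.log N) :=
    (Real.le_log_iff_exp_le (zero_lt_one.trans_le h1)).mpr hN
  have h3 : Real.log N ^ 2 ≤ Real.log N ^ ((2 * (k : ℝ) + 2) * (1 + δ)) := by
    rw [← Real.rpow_two]
    refine Real.rpow_le_rpow_of_exponent_le h1 ?_
    have : (0 : ℝ) ≤ k := Nat.cast_nonneg k
    nlinarith [mul_nonneg this hδ.le]
  have h4 : 1 * Real.log N ^ 2 ≤
      Real.log (Real.log N) ^ 2 * Real.log N ^ ((2 * (k : ℝ) + 2) * (1 + δ)) :=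
    mul_le_mul (one_le_pow₀ h2) h3 (by positivity) (by positivity)
  rw [varianceRate, Real.norm_of_nonneg (by positivity), Real.norm_of_nonneg (by positivity),
    ← mul_div_assoc]
  refine div_le_div_of_nonneg_right ?_ (Nat.cast_nonneg N)
  nlinarith

/-- Averages of local estimates of logarithmic size in an i.i.d. sample of any law are square
integrable, and their variance is `O((log N)² / N)`. -/
lemma memLp_and_variance_isBigO {dx dy k : ℕ} {p : ℝ≥0∞} [Fact (1 ≤ p)]
    (hp : BlockMonotone p dx dy) (hk : 1 ≤ k) {δ : ℝ} (hδ : 0 < δ)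
    {Ω : Type*} [MeasurableSpace Ω] (μ : Measure Ω) [IsProbabilityMeasure μ]
    {Z : ℕ → Ω → (Fin dx → ℝ) × (Fin dy → ℝ)} {ν : Measure ((Fin dx → ℝ) × (Fin dy → ℝ))}
    (hlaw : ∀ i, HasLaw (Z i) ν μ) (hindep : iIndepFun Z μ)
    {c t : ℕ → ℝ} {g : ℕ → ℝ} {C : ℝ} (hc : ∀ N : ℕ, 1 ≤ N → |c N| ≤ C * (1 + Real.log N))
    (hg : ∀ n : ℕ, 1 ≤ n → |g n| ≤ C * (1 + Real.log n))
    (hg' : ∀ n : ℕ, 1 ≤ n → |g (n + 1) - g n| ≤ 1 / n) :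
    (∀ N : ℕ, k < N →
      MemLp (fun ω => averageStat p k (c N) (t N) g fun l : Fin N => Z l ω) 2 μ) ∧
    (fun N : ℕ => variance (fun ω => averageStat p k (c N) (t N) g fun l : Fin N => Z l ω) μ)
      =O[atTop] varianceRate k δ := by
  have hC : 0 ≤ C := by
    have := (abs_nonneg _).trans (hc 1 le_rfl)
    simpa using this
  have hgN : ∀ N n : ℕ, 1 ≤ n → n ≤ N → |g n| ≤ C * (1 + Real.log N) := fun N n hn hnN =>
    (hg n hn).trans (mul_le_mul_of_nonneg_left (add_le_add_right
      (Real.log_le_log (by exact_mod_cast hn) (by exact_mod_cast hnN)) _) hC)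
  have hcN : ∀ N : ℕ, k < N → |c N| ≤ C * (1 + Real.log N) := fun N hN => hc N (by omega)
  have hZ : ∀ N : ℕ, AEMeasurable (fun ω (l : Fin N) => Z l ω) μ := fun N =>
    aemeasurable_pi_lambda _ fun l => (hlaw l).aemeasurable
  have : IsProbabilityMeasure ν := (hlaw 0).map_eq ▸
    Measure.isProbabilityMeasure_map (hlaw 0).aemeasurable
  -- By independence, the first `N` points have the product law, which reduces the claim to product
  -- measures.
  have hmap : ∀ N : ℕ, μ.map (fun ω (l : Fin N) => Z l ω) = Measure.pi fun _ => ν := fun N => by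
    have h := (iIndepFun_iff_map_fun_eq_pi_map (f := fun (l : Fin N) => Z l)
      fun l => (hlaw l).aemeasurable).mp (hindep.precomp (g := fun l : Fin N => (l : ℕ))
        Fin.val_injective)
    rw [h]
    exact congrArg _ (funext fun l => (hlaw l).map_eq)
  refine ⟨fun N hN => ?_, ?_⟩
  · exact MemLp.of_bound
      ((measurable_averageStat p hk hN _ _ _).comp_aemeasurable (hZ N)).aestronglyMeasurable
      _ (ae_of_all _ fun ω => abs_averageStat_le hp hk hN (hcN N hN) (hgN N) _)
  · obtain ⟨K, hK0, hK⟩ := exists_variance_averageStat_le dx dy hp hk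
    refine IsBigO.trans ?_ (log_sq_div_isBigO_varianceRate hδ)
    -- With `B = C (1 + log N)`, one has `B + 2 + log N ≤ (C + 2)(1 + log N)`.
    refine IsBigO.of_bound (K * (C + 2) ^ 2) ?_
    filter_upwards [eventually_gt_atTop k] with N hN
    have hlog : 0 ≤ Real.log N := Real.log_natCast_nonneg N
    have hvar := hK hN (t := t N) (hcN N hN) (hgN N) hg' ν
    rw [← hmap N, variance_map (measurable_averageStat p hk hN _ _ _).aemeasurable (hZ N)] at hvar
    rw [Real.norm_of_nonneg (variance_nonneg _ _), Real.norm_of_nonneg (by positivity)]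
    refine hvar.trans ?_
    rw [← mul_div_assoc, mul_assoc, ← mul_pow]
    gcongr
    linarith

/-! ### The digamma function at the positive integers -/

/-- Harmonic numbers give both the logarithmic size of `ψ(n + 1)` and its increments `1 / (n + 1)`.
-/
lemma psi_natCast_add_one (n : ℕ) :
    psi (n + 1) = harmonic n - Real.eulerMascheroniConstant := by
  rw [psi, logDeriv_apply, Real.deriv_Gamma_nat, Real.Gamma_nat_eq_factorial,
    mul_div_cancel_left₀ _ (by exact_mod_cast n.factorial_ne_zero)]
  ring

lemma abs_psi_natCast_add_one_le (n : ℕ) : |psi (n + 1)| ≤ 1 + Real.log n := by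
  rw [psi_natCast_add_one]
  have h1 := harmonic_le_one_add_log n
  have h2 : (0 : ℝ) ≤ harmonic n := by
    rw [harmonic]; push_cast; exact Finset.sum_nonneg fun _ _ => by positivity
  have h3 := Real.one_half_lt_eulerMascheroniConstant
  have h4 := Real.eulerMascheroniConstant_lt_two_thirds
  have h5 := Real.log_natCast_nonneg n
  rw [abs_le]
  constructor <;> linarith

lemma abs_psi_succ_sub_le {n : ℕ} (hn : 1 ≤ n) :
    |psi ((n + 1 : ℕ) + 1) - psi (n + 1)| ≤ 1 / n := by
  have hn' : (0 : ℝ) < n := by exact_mod_cast hn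
  rw [psi_natCast_add_one, psi_natCast_add_one, harmonic_succ]
  push_cast
  rw [show ∀ a b e : ℝ, a + b - e - (a - e) = b by intros; ring, abs_of_pos (by positivity),
    ← one_div]
  exact one_div_le_one_div_of_le hn' (by linarith)

lemma abs_log_succ_sub_le {n : ℕ} (hn : 1 ≤ n) :
    |Real.log (n + 1 : ℕ) - Real.log n| ≤ 1 / n := by
  have hn' : (0 : ℝ) < n := by exact_mod_cast hn
  push_cast
  rw [← Real.log_div (by positivity) hn'.ne', abs_of_nonneg (Real.log_nonneg
    ((one_le_div hn').mpr (by linarith)))]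
  refine (Real.log_le_sub_one_of_pos (by positivity)).trans (le_of_eq ?_)
  field_simp
  ring

lemma abs_const_add_log_le (a : ℝ) (N : ℕ) :
    |a + Real.log N| ≤ (|a| + 1) * (1 + Real.log N) := by
  have h := Real.log_natCast_nonneg N
  refine (abs_add_le _ _).trans ?_
  rw [abs_of_nonneg h]
  nlinarith [mul_nonneg (abs_nonneg a) h]

end KSG

end

theorem mainTheorem3
    (dx dy k : ℕ) (hdx : 1 ≤ dx) (hdy : 1 ≤ dy) (hk : 1 ≤ k)
    (δ : ℝ) (hδ : 0 < δ)
    (f : (Fin dx → ℝ) × (Fin dy → ℝ) → ℝ)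
    (hf_meas : Measurable f) (hf_nonneg : ∀ z, 0 ≤ f z)
    (hf : KSG.RateAssumption f)
    {Ω : Type*} [MeasurableSpace Ω] (μ : Measure Ω) [IsProbabilityMeasure μ]
    (X : ℕ → Ω → Fin dx → ℝ) (Y : ℕ → Ω → Fin dy → ℝ)
    (hlaw : ∀ i, HasLaw (fun ω => (X i ω, Y i ω))
      (volume.withDensity (fun z => ENNReal.ofReal (f z))) μ)
    (hindep : iIndepFun (fun i ω => (X i ω, Y i ω)) μ) :
    (∀ N : ℕ, k < N →
      MemLp (fun ω => KSG.tKSG k δ (fun i : Fin N => X i ω) (fun i : Fin N => Y i ω)) 2 μ ∧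
      MemLp (fun ω => KSG.tBIKSG k δ (fun i : Fin N => X i ω) (fun i : Fin N => Y i ω)) 2 μ) ∧
    (fun N : ℕ => variance
      (fun ω => KSG.tKSG k δ (fun i : Fin N => X i ω) (fun i : Fin N => Y i ω)) μ)
      =O[atTop] KSG.varianceRate k δ ∧
    (fun N : ℕ => variance
      (fun ω => KSG.tBIKSG k δ (fun i : Fin N => X i ω) (fun i : Fin N => Y i ω)) μ)
      =O[atTop] KSG.varianceRate k δ := by
  have hlog : ∀ (a : ℝ) (n : ℕ), 1 + Real.log n ≤ (|a| + 1) * (1 + Real.log n) := fun a n => by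
    have h := Real.log_natCast_nonneg n
    nlinarith [mul_nonneg (abs_nonneg a) h, abs_nonneg a]
  -- The ball volumes only shift the constant: the leading term for `p = 2` is `a + log N`.
  set a := KSG.psi k + Real.log (KSG.ballVol dx * KSG.ballVol dy / KSG.ballVol (dx + dy)) with ha
  have h1 := KSG.memLp_and_variance_isBigO (KSG.blockMonotone_top dx dy) hk hδ μ hlaw hindep
    (c := fun N => KSG.psi k + Real.log N) (t := KSG.threshold dx dy δ)
    (g := fun n => KSG.psi (n + 1)) (C := |KSG.psi k| + 1)
    (fun N _ => KSG.abs_const_add_log_le _ N)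
    (fun n _ => (KSG.abs_psi_natCast_add_one_le n).trans (hlog _ n))
    (fun n hn => KSG.abs_psi_succ_sub_le hn)
  have h2 := KSG.memLp_and_variance_isBigO (KSG.blockMonotone_two dx dy) hk hδ μ hlaw hindep
    (c := fun N => KSG.psi k + Real.log N +
      Real.log (KSG.ballVol dx * KSG.ballVol dy / KSG.ballVol (dx + dy)))
    (t := KSG.threshold dx dy δ) (g := fun n => Real.log n) (C := |a| + 1)
    (fun N _ => by
      rw [add_right_comm, ← ha]
      exact KSG.abs_const_add_log_le _ N)
    (fun n _ => by
      rw [abs_of_nonneg (Real.log_natCast_nonneg n)]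
      exact le_trans (by linarith) (hlog a n))
    (fun n hn => KSG.abs_log_succ_sub_le hn)
  simp only [KSG.tKSG, KSG.tBIKSG, KSG.iotaInf_eq, KSG.iotaTwo_eq]
  exact ⟨fun N hN => ⟨h1.1 N hN, h2.1 N hN⟩, h1.2, h2.2⟩
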